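/- Let $n\ge 1$, and let $\pi_1,\dots,\pi_n$ be independent, uniformly distributed random permutations of $\{1,2\}$. Put $$S_j=\frac{\sqrt{12}}{\sqrt{r(r+1)n}}\sum_{i=1}^n\Big(\pi_i(j)-\frac{r+1}{2}\Big)\quad(r=2,\ j=1,2),\qquad F_2=S_1^2+S_2^2$$ (Friedman's statistic for $r=2$ treatments and $n$ trials). Let $\chi^2_{(1)}$ denote the chi-square distribution with one degree of freedom, and write $\chi^2_{(1)}h=\mathbb{E}[h(Y)]$ for $Y\sim\chi^2_{(1)}$. Let $d_{\mathrm W}$ denote the Wasserstein distance, $d_{\mathrm W}(\mathcal L(X),\mathcal L(Y))=\sup_{h}|\mathbb{E}[h(X)]-\mathbb{E}[h(Y)]|$, where the supremum is over all $h:\mathbb{R}\to\mathbb{R}$ with Lipschitz constant at most $1$. Then $F_2$ and $\chi^2_{(1)}$ have finite first moments and $$d_{\mathrm W}(\mathcal L(F_2),\chi^2_{(1)})\le\frac{1}{\sqrt n}\Big(87+\frac{48}{\sqrt n}\Big).$$ Moreover, let $h:[0,\infty)\to\mathbb{R}$ be twice differentiable (with one-sided derivatives at $0$), with $h'$ and $h''$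 bounded; neither boundedness of $h$ nor continuity of $h''$ is assumed. Then $h(F_2)$ and $h(Y)$ are integrable and $$\big|\mathbb{E}[h(F_2)]-\chi^2_{(1)}h\big|\le\frac1n\Big(69+\frac{43}{n}\Big)\big(\|h'\|+\|h''\|\big),$$ where $\|g\|=\sup_{x\ge0}|g(x)|$. -/

import Mathlib

open MeasureTheory ProbabilityTheory
open scoped ENNReal

namespace Friedman

/-- The finite set of permutations carries the discrete sigma-algebra. -/
instance permMeasurableSpace (r : ℕ) : MeasurableSpace (Equiv.Perm (Fin r)) := ⊤

/-- The rankings `π 0, …, π (n - 1)` of `r` treatments in `n` trials under the null hypothesis: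
independent random permutations, each uniformly distributed. -/
structure IsUniformRankings {Ω : Type*} [MeasurableSpace Ω] (P : Measure Ω) {n r : ℕ}
    (π : Fin n → Ω → Equiv.Perm (Fin r)) : Prop where
  measurable : ∀ i, Measurable (π i)
  indep : iIndepFun π P
  uniform : ∀ i, P.map (π i) = uniformOn Set.univ

/-- The centred rank `ρ(j) = π(j) - (r + 1) / 2`. The ranks `1, …, r` of the treatments are the
elements of `Fin r` shifted by one. -/
noncomputable def centredRank {r : ℕ} (σ : Equiv.Perm (Fin r)) (j : Fin r) : ℝ :=
  (((σ j : ℕ) : ℝ) + 1) - ((r : ℝ) + 1) / 2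

/-- `S_j = √12 / √(r (r + 1) n) * ∑ i, ρ_i(j)`, for given rankings `σ`. -/
noncomputable def rankSum {n r : ℕ} (σ : Fin n → Equiv.Perm (Fin r)) (j : Fin r) : ℝ :=
  √12 / √((r : ℝ) * ((r : ℝ) + 1) * (n : ℝ)) * ∑ i, centredRank (σ i) j

/-- Friedman's statistic `F_r = ∑ j, S_j ^ 2`, for given rankings `σ`. -/
noncomputable def statistic {n r : ℕ} (σ : Fin n → Equiv.Perm (Fin r)) : ℝ :=
  ∑ j, rankSum σ j ^ 2

/-- The chi-square distribution with `p` degrees of freedom: the law of the sum of the squares of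
`p` independent standard normal random variables. -/
noncomputable def chiSquare (p : ℕ) : Measure ℝ :=
  (Measure.pi fun _ : Fin p => gaussianReal 0 1).map fun x => ∑ i, x i ^ 2

/-- The Wasserstein distance between two probability distributions on the line with finite first
moments: the supremum of `|E h(X) - E h(Y)|` over the `h` with Lipschitz constant at most `1`. -/
noncomputable def wassersteinDist (μ ν : Measure ℝ) : ℝ≥0∞ :=
  ⨆ (h : ℝ → ℝ) (_ : LipschitzWith 1 h), ENNReal.ofReal |∫ x, h x ∂μ - ∫ x, h x ∂ν|

/-- The `m`-th derivative of `h` on `[0, ∞)`, one-sided at `0`. Only the values of `h` on `[0, ∞)`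
matter. -/
noncomputable def derivPos (m : ℕ) (h : ℝ → ℝ) : ℝ → ℝ :=
  iteratedDerivWithin m h (Set.Ici 0)

/-- The class `C_b^{j,k}` of functions on `[0, ∞)` that are `k` times differentiable, with bounded
derivatives of orders `j, …, k`. The `k`-th derivative need not be continuous. -/
structure MemCb (j k : ℕ) (h : ℝ → ℝ) : Prop where
  differentiable : ∀ m < k, DifferentiableOn ℝ (derivPos m h) (Set.Ici 0)
  bounded : ∀ m, j ≤ m → m ≤ k → ∃ C : ℝ, ∀ x ∈ Set.Ici (0 : ℝ), |derivPos m h x| ≤ C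

/-- The supremum norm over `[0, ∞)` (of functions that are bounded there). -/
noncomputable def supNorm (g : ℝ → ℝ) : ℝ :=
  ⨆ x : Set.Ici (0 : ℝ), |g x|

end Friedman

namespace Friedman

open Filter Set
open scoped Topology

/-! For two treatments the centred ranks are opposite, so the statistic is `W ^ 2`, where `W` is a
sum of `n` independent random signs divided by `√n`; the target is the law of `Z ^ 2`, `Z` standard
normal. Stein's method is applied to the even function `h (x ^ 2)`: with `ψ' - x ψ = h (x ^ 2) - E h
(Z ^ 2)`, the error is the mean of `ψ' (W) - W ψ (W)`.

Flipping one sign preserves the uniform law and moves `W` by `2 / √n`. Symmetrising under the flip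
turns each sign's contribution into a trapezoid-rule error, of order `n ^ (-3/2)` times a bound on
`ψ'''`. Hence the rate `1 / n` in `abs_sum_signSum_mul_sub_le`.

Each derivative of `ψ` solves `u' - x u = k` with a known `k`, so the comparison principle with
explicit barriers (`abs_le_barrier`) bounds them successively, ending with `abs_steinSolDeriv3_le`.
Mean value inequalities replace Taylor integrals, so `h''` need not be continuous.

A Lipschitz `h` is first smoothed by averaging twice at scale `1 / √n`, which costs the slower rate.
-/

/-! ### Comparison principle for `u' - x u = k` -/

theorem tendsto_mul_exp_neg_sq_of_le {u : ℝ → ℝ} {C : ℝ}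
    (hu : ∀ x, 0 ≤ x → |u x| ≤ C * (1 + x ^ 2)) :
    Tendsto (fun x => u x * Real.exp (-(x ^ 2 / 2))) atTop (𝓝 0) := by
  have hsq : Tendsto (fun x : ℝ => x ^ 2 / 2) atTop atTop :=
    (tendsto_pow_atTop two_ne_zero).atTop_div_const two_pos
  have h0 := (Real.tendsto_pow_mul_exp_neg_atTop_nhds_zero 0).comp hsq
  have h1 := (Real.tendsto_pow_mul_exp_neg_atTop_nhds_zero 1).comp hsq
  have h2 := (h0.add (h1.const_mul 2)).const_mul C
  simp only [mul_zero, add_zero] at h2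
  refine squeeze_zero_norm' ?_ h2
  filter_upwards [eventually_ge_atTop 0] with x hx
  have hE := Real.exp_pos (-(x ^ 2 / 2))
  rw [Real.norm_eq_abs, abs_mul, abs_of_pos hE]
  calc |u x| * Real.exp (-(x ^ 2 / 2)) ≤ C * (1 + x ^ 2) * Real.exp (-(x ^ 2 / 2)) :=
        mul_le_mul_of_nonneg_right (hu x hx) hE.le
    _ = _ := by simp only [Function.comp]; ring

theorem hasDerivAt_exp_neg_sq (x : ℝ) :
    HasDerivAt (fun x : ℝ => Real.exp (-(x ^ 2 / 2))) (-x * Real.exp (-(x ^ 2 / 2))) x := by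
  have h : HasDerivAt (fun x : ℝ => x ^ 2 / 2) x x := by
    simpa using ((hasDerivAt_id' x).fun_pow 2).div_const 2
  simpa [mul_comm] using h.fun_neg.exp

theorem hasDerivAt_exp_sq (x : ℝ) :
    HasDerivAt (fun x : ℝ => Real.exp (x ^ 2 / 2)) (x * Real.exp (x ^ 2 / 2)) x := by
  have h : HasDerivAt (fun x : ℝ => x ^ 2 / 2) x x := by
    simpa using ((hasDerivAt_id' x).fun_pow 2).div_const 2
  simpa [mul_comm] using h.exp

/-- Subsolutions of `u' = x u` on the half-line that are negligible against `exp (x ^ 2 / 2)`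
are nonpositive. -/
theorem nonpos_of_mul_le_deriv {u u' : ℝ → ℝ} (hu : ∀ x, 0 ≤ x → HasDerivAt u (u' x) x)
    (hle : ∀ x, 0 ≤ x → x * u x ≤ u' x)
    (hlim : Tendsto (fun x => u x * Real.exp (-(x ^ 2 / 2))) atTop (𝓝 0)) {x : ℝ} (hx : 0 ≤ x) :
    u x ≤ 0 := by
  have hd : ∀ y, 0 ≤ y → HasDerivAt (fun x => u x * Real.exp (-(x ^ 2 / 2)))
      ((u' y - y * u y) * Real.exp (-(y ^ 2 / 2))) y := fun y hy => by
    exact ((hu y hy).fun_mul (hasDerivAt_exp_neg_sq y)).congr_deriv (by ring)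
  -- The integrating factor makes the product nondecreasing; being below its limit `0`, it is
  -- nonpositive.
  have hmono : MonotoneOn (fun x => u x * Real.exp (-(x ^ 2 / 2))) (Ici 0) := by
    refine monotoneOn_of_deriv_nonneg (convex_Ici 0)
      (fun y hy => (hd y hy).continuousAt.continuousWithinAt) ?_ ?_
    · intro y hy
      rw [interior_Ici] at hy
      exact (hd y (le_of_lt hy)).differentiableAt.differentiableWithinAt
    · intro y hy
      rw [interior_Ici] at hy
      rw [(hd y (le_of_lt hy)).deriv]
      exact mul_nonneg (sub_nonneg.2 (hle y (le_of_lt hy))) (Real.exp_pos _).le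
  have h0 : u x * Real.exp (-(x ^ 2 / 2)) ≤ 0 := by
    refine ge_of_tendsto hlim ?_
    filter_upwards [eventually_ge_atTop x] with y hy
    exact hmono hx (mem_Ici.2 (hx.trans hy)) hy
  by_contra! h
  exact absurd h0 (not_le.2 (mul_pos h (Real.exp_pos _)))

/-- Comparison principle for the equation `u' - x u = k` on the half-line. -/
theorem abs_le_of_abs_le_mul_sub_deriv {u k G G' : ℝ → ℝ}
    (hu : ∀ x, 0 ≤ x → HasDerivAt u (x * u x + k x) x)
    (hG : ∀ x, 0 ≤ x → HasDerivAt G (G' x) x)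
    (hk : ∀ x, 0 ≤ x → |k x| ≤ x * G x - G' x)
    (hulim : Tendsto (fun x => u x * Real.exp (-(x ^ 2 / 2))) atTop (𝓝 0))
    (hGlim : Tendsto (fun x => G x * Real.exp (-(x ^ 2 / 2))) atTop (𝓝 0))
    {x : ℝ} (hx : 0 ≤ x) : |u x| ≤ G x := by
  rw [abs_le]
  constructor
  · have := nonpos_of_mul_le_deriv (u := fun x => -u x - G x)
      (u' := fun x => -(x * u x + k x) - G' x)
      (fun y hy => (hu y hy).neg.sub (hG y hy))
      (fun y hy => by nlinarith [(abs_le.1 (hk y hy)).2])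
      (by simpa [sub_mul] using hulim.neg.sub hGlim) hx
    linarith
  · have := nonpos_of_mul_le_deriv (u := fun x => u x - G x)
      (u' := fun x => (x * u x + k x) - G' x)
      (fun y hy => (hu y hy).sub (hG y hy))
      (fun y hy => by nlinarith [(abs_le.1 (hk y hy)).1])
      (by simpa [sub_mul] using hulim.sub hGlim) hx
    linarith

/-- An explicit barrier `p + q x + r / (1 + x)` for the comparison principle. -/
theorem abs_le_barrier {u k : ℝ → ℝ} {p q r : ℝ} (hp : 0 ≤ p) (hq : 0 ≤ q) (hr : 0 ≤ r)
    (hu : ∀ x, 0 ≤ x → HasDerivAt u (x * u x + k x) x)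
    (hk : ∀ x, 0 ≤ x → |k x| ≤ p * x + q * (x ^ 2 - 1) + r * ((x ^ 2 + x + 1) / (1 + x) ^ 2))
    (hulim : Tendsto (fun x => u x * Real.exp (-(x ^ 2 / 2))) atTop (𝓝 0))
    {x : ℝ} (hx : 0 ≤ x) : |u x| ≤ p + q * x + r / (1 + x) := by
  refine abs_le_of_abs_le_mul_sub_deriv (k := k) (G := fun x => p + q * x + r / (1 + x))
    (G' := fun x => q - r / (1 + x) ^ 2) hu ?_ ?_ hulim ?_ hx
  · intro y hy
    have h1 : (1 + y) ≠ 0 := by positivity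
    exact ((((hasDerivAt_id' y).const_mul q).const_add p).fun_add
      ((hasDerivAt_const y r).fun_div ((hasDerivAt_id' y).const_add 1) h1)).congr_deriv (by ring)
  · intro y hy
    -- The bound on `k` is exactly `x G - G'`, computed term by term for this barrier.
    refine (hk y hy).trans (le_of_eq ?_)
    field_simp
    ring
  · refine tendsto_mul_exp_neg_sq_of_le (C := p + q + r) fun y hy => ?_
    have h1 : r / (1 + y) ≤ r := div_le_self hr (by linarith)
    have h2 : y ≤ 1 + y ^ 2 := by nlinarith [sq_nonneg (y - 1)]
    rw [abs_of_nonneg (by positivity)]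
    nlinarith [mul_le_mul_of_nonneg_left h2 hq, mul_nonneg hp (sq_nonneg y),
      mul_nonneg hr (sq_nonneg y)]

/-- The right side is `1 - x / (1 + x) ^ 2`, smallest at `x = 1`. Thus a constant forcing `c` is
absorbed by the barrier with `r = 4 c / 3`. -/
theorem three_quarters_le_barrier {x : ℝ} (hx : 0 ≤ x) :
    3 / 4 ≤ (x ^ 2 + x + 1) / (1 + x) ^ 2 := by
  rw [le_div_iff₀ (by positivity)]
  nlinarith [sq_nonneg (x - 1)]

theorem one_div_le_barrier {x : ℝ} (hx : 0 ≤ x) :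
    1 / (1 + x) ≤ (x ^ 2 + x + 1) / (1 + x) ^ 2 := by
  rw [div_le_div_iff₀ (by positivity) (by positivity)]
  nlinarith [pow_nonneg hx 2, pow_nonneg hx 3]

/-! ### Gaussian expectations of `h (x ^ 2)` -/

theorem integrable_pow_gaussianReal (m : ℕ) : Integrable (fun x : ℝ => x ^ m) (gaussianReal 0 1) := by
  by_cases hm : m = 0
  · subst hm; simp
  have := (memLp_id_gaussianReal (μ := 0) (v := 1) (m : NNReal))
  have := this.integrable_norm_pow (by exact_mod_cast hm)
  refine this.mono' (by fun_prop) ?_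
  simp

theorem integral_sq_gaussianReal : ∫ x : ℝ, x ^ 2 ∂(gaussianReal 0 1) = 1 := by
  have h := variance_id_gaussianReal (μ := 0) (v := 1)
  rw [variance_eq_integral (by fun_prop)] at h
  simpa using h

theorem integrable_comp_sq_gaussianReal {h : ℝ → ℝ} {A : ℝ} (hc : ContinuousOn h (Ici 0))
    (hA : ∀ x y, 0 ≤ x → 0 ≤ y → |h x - h y| ≤ A * |x - y|) :
    Integrable (fun x : ℝ => h (x ^ 2)) (gaussianReal 0 1) := by
  have hcont : Continuous fun x : ℝ => h (x ^ 2) :=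
    hc.comp_continuous (by fun_prop) fun x => sq_nonneg x
  refine (((integrable_pow_gaussianReal 2).const_mul A).add
    (integrable_const |h 0|)).mono' hcont.aestronglyMeasurable (ae_of_all _ fun x => ?_)
  have h1 := hA (x ^ 2) 0 (sq_nonneg x) le_rfl
  rw [sub_zero, abs_of_nonneg (sq_nonneg x)] at h1
  have h2 := abs_sub_abs_le_abs_sub (h (x ^ 2)) (h 0)
  simp only [Real.norm_eq_abs, Pi.add_apply]
  linarith

/-- Average `|h (x ^ 2) - h (y ^ 2)| ≤ A (x ^ 2 + y ^ 2)` over a standard normal `y`, whose second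
moment is `1`. -/
theorem abs_comp_sq_sub_integral_le {h : ℝ → ℝ} {A : ℝ} (hc : ContinuousOn h (Ici 0))
    (hA : ∀ x y, 0 ≤ x → 0 ≤ y → |h x - h y| ≤ A * |x - y|) (hA0 : 0 ≤ A) (x : ℝ) :
    |h (x ^ 2) - ∫ y : ℝ, h (y ^ 2) ∂(gaussianReal 0 1)| ≤ A * (1 + x ^ 2) := by
  have hi := integrable_comp_sq_gaussianReal hc hA
  have h1 : h (x ^ 2) - ∫ y : ℝ, h (y ^ 2) ∂(gaussianReal 0 1)
      = ∫ y : ℝ, (h (x ^ 2) - h (y ^ 2)) ∂(gaussianReal 0 1) := by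
    rw [integral_sub (integrable_const _) hi]; simp
  have h2 : ∫ y : ℝ, A * (x ^ 2 + y ^ 2) ∂(gaussianReal 0 1) = A * (1 + x ^ 2) := by
    rw [integral_const_mul, integral_add (integrable_const _) (integrable_pow_gaussianReal 2),
      integral_sq_gaussianReal]
    simp [add_comm]
  rw [h1, ← h2, ← Real.norm_eq_abs]
  refine norm_integral_le_of_norm_le
    (((integrable_const _).add (integrable_pow_gaussianReal 2)).const_mul A)
    (ae_of_all _ fun y => ?_)
  refine (hA _ _ (sq_nonneg x) (sq_nonneg y)).trans (mul_le_mul_of_nonneg_left ?_ hA0)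
  rw [abs_le]
  constructor <;> nlinarith [sq_nonneg x, sq_nonneg y]

/-! ### The Stein equation and its solution -/

/-- The odd solution `ψ` of the Stein equation `ψ' - x ψ = h (x ^ 2) - E h (Z ^ 2)`. -/
noncomputable def steinSol (h : ℝ → ℝ) (x : ℝ) : ℝ :=
  Real.exp (x ^ 2 / 2) * ∫ t in (0 : ℝ)..x,
    (h (t ^ 2) - ∫ y : ℝ, h (y ^ 2) ∂(gaussianReal 0 1)) * Real.exp (-(t ^ 2 / 2))

/-- The derivative of `steinSol h`. -/
noncomputable def steinSolDeriv (h : ℝ → ℝ) (x : ℝ) : ℝ :=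
  x * steinSol h x + (h (x ^ 2) - ∫ y : ℝ, h (y ^ 2) ∂(gaussianReal 0 1))

theorem steinSol_neg (h : ℝ → ℝ) (x : ℝ) : steinSol h (-x) = -steinSol h x := by
  have := intervalIntegral.integral_comp_neg (a := 0) (b := x) fun t : ℝ =>
    (h (t ^ 2) - ∫ y : ℝ, h (y ^ 2) ∂(gaussianReal 0 1)) * Real.exp (-(t ^ 2 / 2))
  simp only [neg_sq, neg_zero] at this
  rw [steinSol, steinSol, this, intervalIntegral.integral_symm, neg_sq]
  ring

theorem steinSolDeriv_neg (h : ℝ → ℝ) (x : ℝ) : steinSolDeriv h (-x) = steinSolDeriv h x := by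
  rw [steinSolDeriv, steinSolDeriv, steinSol_neg, neg_sq]
  ring

theorem hasDerivAt_steinSol {h : ℝ → ℝ} (hc : ContinuousOn h (Ici 0)) (x : ℝ) :
    HasDerivAt (steinSol h) (steinSolDeriv h x) x := by
  have hcont : Continuous fun x : ℝ => h (x ^ 2) :=
    hc.comp_continuous (by fun_prop) fun x => sq_nonneg x
  have hg : Continuous fun t : ℝ =>
    (h (t ^ 2) - ∫ y : ℝ, h (y ^ 2) ∂(gaussianReal 0 1)) * Real.exp (-(t ^ 2 / 2)) :=
    (hcont.sub continuous_const).mul (by fun_prop)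
  refine ((hasDerivAt_exp_sq x).fun_mul
    (hg.integral_hasStrictDerivAt 0 x).hasDerivAt).congr_deriv ?_
  have : Real.exp (x ^ 2 / 2) * Real.exp (-(x ^ 2 / 2)) = 1 := by rw [← Real.exp_add]; simp
  rw [steinSolDeriv, steinSol]
  linear_combination (h (x ^ 2) - ∫ y : ℝ, h (y ^ 2) ∂(gaussianReal 0 1)) * this

theorem gaussianPDFReal_zero_one (x : ℝ) :
    gaussianPDFReal 0 1 x = (√(2 * Real.pi))⁻¹ * Real.exp (-(x ^ 2 / 2)) := by
  simp [gaussianPDFReal, neg_div]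

/-- The product is the integral over `[0, x]` of a centred even function against the Gaussian
weight. The integral over the line vanishes by centring, hence by evenness so does the one over the
half-line. -/
theorem tendsto_steinSol {h : ℝ → ℝ} {A : ℝ} (hc : ContinuousOn h (Ici 0))
    (hA : ∀ x y, 0 ≤ x → 0 ≤ y → |h x - h y| ≤ A * |x - y|) :
    Tendsto (fun x => steinSol h x * Real.exp (-(x ^ 2 / 2))) atTop (𝓝 0) := by
  set c := ∫ y : ℝ, h (y ^ 2) ∂(gaussianReal 0 1) with hcdef
  have hi := integrable_comp_sq_gaussianReal hc hA
  have hi2 : Integrable (fun x : ℝ => h (x ^ 2) - c) (gaussianReal 0 1) :=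
    hi.sub (integrable_const c)
  have hpos : (0 : ℝ) < (√(2 * Real.pi))⁻¹ := by positivity
  have hint : Integrable fun t : ℝ => (h (t ^ 2) - c) * Real.exp (-(t ^ 2 / 2)) := by
    rw [gaussianReal_of_var_ne_zero 0 one_ne_zero] at hi2
    rw [integrable_withDensity_iff_integrable_smul' (by fun_prop)
      (ae_of_all _ fun _ => gaussianPDF_lt_top)] at hi2
    refine (hi2.const_mul (√(2 * Real.pi))).congr (ae_of_all _ fun x => ?_)
    simp only [toReal_gaussianPDF, gaussianPDFReal_zero_one, smul_eq_mul]
    field_simp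
  have hzero : ∫ t : ℝ, (h (t ^ 2) - c) * Real.exp (-(t ^ 2 / 2)) = 0 := by
    have h1 : ∫ t : ℝ, (h (t ^ 2) - c) ∂(gaussianReal 0 1) = 0 := by
      rw [integral_sub hi (integrable_const c)]; simp [hcdef]
    rw [integral_gaussianReal_eq_integral_smul one_ne_zero] at h1
    have h2 : (√(2 * Real.pi))⁻¹ * ∫ t : ℝ, (h (t ^ 2) - c) * Real.exp (-(t ^ 2 / 2)) = 0 := by
      rw [← integral_const_mul, ← h1]
      congr 1 with t
      rw [gaussianPDFReal_zero_one, smul_eq_mul]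
      ring
    exact (mul_eq_zero.1 h2).resolve_left hpos.ne'
  have hIoi : ∫ t in Ioi (0 : ℝ), (h (t ^ 2) - c) * Real.exp (-(t ^ 2 / 2)) = 0 := by
    have := integral_comp_abs (f := fun t : ℝ => (h (t ^ 2) - c) * Real.exp (-(t ^ 2 / 2)))
    simp only [sq_abs] at this
    linarith
  have hlim := intervalIntegral_tendsto_integral_Ioi (μ := volume) 0 hint.integrableOn tendsto_id
  rw [hIoi] at hlim
  refine hlim.congr fun x => ?_
  have : Real.exp (x ^ 2 / 2) * Real.exp (-(x ^ 2 / 2)) = 1 := by rw [← Real.exp_add]; simp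
  simp only [steinSol, ← hcdef, id]
  rw [mul_right_comm, this, one_mul]

/-! ### Bounds on the derivatives of the Stein solution -/

section Bounds

variable {h h' h'' : ℝ → ℝ} {A B : ℝ}

/-- Squaring maps the line into `[0, ∞)`, so one-sided differentiability of `h` at `0` gives a
two-sided derivative here. -/
theorem hasDerivAt_comp_sq (h1 : ∀ x, 0 ≤ x → HasDerivWithinAt h (h' x) (Ici 0) x) (x : ℝ) :
    HasDerivAt (fun x : ℝ => h (x ^ 2)) (2 * x * h' (x ^ 2)) x := by
  have h2 : HasDerivAt (fun x : ℝ => x ^ 2) (2 * x) x := by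
    simpa using (hasDerivAt_id' x).fun_pow 2
  have := HasDerivWithinAt.comp (h := fun x : ℝ => x ^ 2) (s := univ) x
    (h1 (x ^ 2) (sq_nonneg x)) h2.hasDerivWithinAt fun y _ => sq_nonneg y
  rw [hasDerivWithinAt_univ] at this
  rw [mul_comm]
  exact this

theorem abs_sub_le_of_hasDerivWithinAt
    (h1 : ∀ x, 0 ≤ x → HasDerivWithinAt h (h' x) (Ici 0) x) (hA : ∀ x, 0 ≤ x → |h' x| ≤ A)
    (x y : ℝ) (hx : 0 ≤ x) (hy : 0 ≤ y) : |h x - h y| ≤ A * |x - y| :=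
  (convex_Ici (0 : ℝ)).norm_image_sub_le_of_norm_hasDerivWithin_le (fun z hz => h1 z hz)
    (fun z hz => hA z hz) hy hx

theorem abs_steinSol_le (hc : ContinuousOn h (Ici 0))
    (hA : ∀ x y, 0 ≤ x → 0 ≤ y → |h x - h y| ≤ A * |x - y|) (hA0 : 0 ≤ A) {x : ℝ} (hx : 0 ≤ x) :
    |steinSol h x| ≤ A * x + 8 / 3 * A / (1 + x) := by
  -- Write `A (1 + x ^ 2) = A (x ^ 2 - 1) + 2 A`; the constant `2 A` is absorbed by `r = (4 / 3) 2
  -- A`.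
  have := abs_le_barrier (p := 0) (q := A) (r := 8 / 3 * A) le_rfl hA0 (by positivity)
    (fun x _ => hasDerivAt_steinSol hc x) (fun x hx => ?_) (tendsto_steinSol hc hA) hx
  · simpa using this
  · have h2 := abs_comp_sq_sub_integral_le hc hA hA0 x
    nlinarith [mul_le_mul_of_nonneg_left (three_quarters_le_barrier hx) hA0]

theorem hasDerivAt_steinSolDeriv (h1 : ∀ x, 0 ≤ x → HasDerivWithinAt h (h' x) (Ici 0) x) (x : ℝ) :
    HasDerivAt (steinSolDeriv h)
      (x * steinSolDeriv h x + (steinSol h x + 2 * x * h' (x ^ 2))) x := by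
  have hc : ContinuousOn h (Ici 0) := fun x hx => (h1 x hx).continuousWithinAt
  exact (((hasDerivAt_id' x).fun_mul (hasDerivAt_steinSol hc x)).fun_add
    ((hasDerivAt_comp_sq h1 x).sub_const _)).congr_deriv (by ring)

theorem abs_steinSolDeriv_le (h1 : ∀ x, 0 ≤ x → HasDerivWithinAt h (h' x) (Ici 0) x)
    (hA : ∀ x, 0 ≤ x → |h' x| ≤ A) (x : ℝ) : |steinSolDeriv h x| ≤ 17 / 3 * A := by
  have hA0 : 0 ≤ A := (abs_nonneg _).trans (hA 0 le_rfl)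
  have hc : ContinuousOn h (Ici 0) := fun x hx => (h1 x hx).continuousWithinAt
  have hL := abs_sub_le_of_hasDerivWithinAt h1 hA
  wlog hx : 0 ≤ x generalizing x
  · rw [← steinSolDeriv_neg]
    exact this (-x) (by linarith)
  have hψ : ∀ x, 0 ≤ x → |steinSol h x| ≤ A * x + 8 / 3 * A / (1 + x) :=
    fun x hx => abs_steinSol_le hc hL hA0 hx
  -- The forcing is `ψ + 2 x h' (x ^ 2)`, at most `3 A x + (8 / 3) A / (1 + x)`.
  have := abs_le_barrier (p := 3 * A) (q := 0) (r := 8 / 3 * A) (by positivity) le_rfl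
    (by positivity) (fun x _ => hasDerivAt_steinSolDeriv h1 x) (fun x hx => ?_) ?_ hx
  · have h2 : 8 / 3 * A / (1 + x) ≤ 8 / 3 * A := div_le_self (by positivity) (by linarith)
    linarith
  · have h2 : |2 * x * h' (x ^ 2)| ≤ 2 * x * A := by
      rw [abs_mul, abs_of_nonneg (by positivity : 0 ≤ 2 * x)]
      exact mul_le_mul_of_nonneg_left (hA _ (sq_nonneg x)) (by positivity)
    have h3 := mul_le_mul_of_nonneg_left (one_div_le_barrier hx)
      (by positivity : 0 ≤ 8 / 3 * A)
    rw [mul_one_div] at h3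
    linarith [abs_add_le (steinSol h x) (2 * x * h' (x ^ 2)), hψ x hx]
  · refine tendsto_mul_exp_neg_sq_of_le (C := 5 * A) fun x hx => ?_
    have h2 := abs_comp_sq_sub_integral_le hc hL hA0 x
    have h3 : |x * steinSol h x| ≤ A * x ^ 2 + 8 / 3 * A := by
      rw [abs_mul, abs_of_nonneg hx]
      have h4 : x * (8 / 3 * A / (1 + x)) ≤ 8 / 3 * A := by
        rw [mul_div_assoc', div_le_iff₀ (by positivity)]
        nlinarith
      nlinarith [mul_le_mul_of_nonneg_left (hψ x hx) hx]
    have h4 := abs_add_le (x * steinSol h x)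
      (h (x ^ 2) - ∫ y : ℝ, h (y ^ 2) ∂(gaussianReal 0 1))
    rw [steinSolDeriv]
    nlinarith [mul_nonneg hA0 (sq_nonneg x)]

/-- The second derivative of `steinSol h`, given the derivative `h'` of `h`. -/
noncomputable def steinSolDeriv2 (h h' : ℝ → ℝ) (x : ℝ) : ℝ :=
  x * steinSolDeriv h x + (steinSol h x + 2 * x * h' (x ^ 2))

/-- The third derivative of `steinSol h`, given the derivatives `h'` and `h''` of `h`. -/
noncomputable def steinSolDeriv3 (h h' h'' : ℝ → ℝ) (x : ℝ) : ℝ :=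
  x * steinSolDeriv2 h h' x +
    (2 * steinSolDeriv h x + (2 * h' (x ^ 2) + 4 * x ^ 2 * h'' (x ^ 2)))

theorem hasDerivAt_steinSolDeriv2 (h1 : ∀ x, 0 ≤ x → HasDerivWithinAt h (h' x) (Ici 0) x)
    (h2 : ∀ x, 0 ≤ x → HasDerivWithinAt h' (h'' x) (Ici 0) x) (x : ℝ) :
    HasDerivAt (steinSolDeriv2 h h') (steinSolDeriv3 h h' h'' x) x := by
  have hc : ContinuousOn h (Ici 0) := fun x hx => (h1 x hx).continuousWithinAt
  refine (((hasDerivAt_id' x).fun_mul (hasDerivAt_steinSolDeriv h1 x)).fun_add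
    ((hasDerivAt_steinSol hc x).fun_add
      (((hasDerivAt_id' x).const_mul 2).fun_mul (hasDerivAt_comp_sq h2 x)))).congr_deriv ?_
  rw [steinSolDeriv3, steinSolDeriv2]
  ring

theorem abs_steinSolDeriv3_le (h1 : ∀ x, 0 ≤ x → HasDerivWithinAt h (h' x) (Ici 0) x)
    (h2 : ∀ x, 0 ≤ x → HasDerivWithinAt h' (h'' x) (Ici 0) x)
    (hA : ∀ x, 0 ≤ x → |h' x| ≤ A) (hB : ∀ x, 0 ≤ x → |h'' x| ≤ B) (x : ℝ) :
    |steinSolDeriv3 h h' h'' x| ≤ 32 * A + 6 * B + 8 * B * x ^ 2 := by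
  have hA0 : 0 ≤ A := (abs_nonneg _).trans (hA 0 le_rfl)
  have hB0 : 0 ≤ B := (abs_nonneg _).trans (hB 0 le_rfl)
  have hc : ContinuousOn h (Ici 0) := fun x hx => (h1 x hx).continuousWithinAt
  have hL := abs_sub_le_of_hasDerivWithinAt h1 hA
  have hneg : steinSolDeriv3 h h' h'' (-x) = steinSolDeriv3 h h' h'' x := by
    simp only [steinSolDeriv3, steinSolDeriv2, steinSol_neg, steinSolDeriv_neg, neg_sq]
    ring
  wlog hx : 0 ≤ x generalizing x
  · have := this (-x) (by rw [neg_neg, hneg]) (by linarith)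
    rwa [hneg, neg_sq] at this
  have hk : ∀ x, |2 * steinSolDeriv h x + (2 * h' (x ^ 2) + 4 * x ^ 2 * h'' (x ^ 2))|
      ≤ 40 / 3 * A + 4 * B * x ^ 2 := fun x => by
    have e1 := abs_le.1 (abs_steinSolDeriv_le h1 hA x)
    have e2 := abs_le.1 (hA (x ^ 2) (sq_nonneg x))
    have e3 := abs_le.1 (hB (x ^ 2) (sq_nonneg x))
    rw [abs_le]
    constructor <;> nlinarith [mul_le_mul_of_nonneg_left e3.1 (sq_nonneg x),
      mul_le_mul_of_nonneg_left e3.2 (sq_nonneg x)]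
  have hψ2 : |steinSolDeriv2 h h' x| ≤
      0 + 4 * B * x + (160 / 9 * A + 16 / 3 * B) / (1 + x) := by
    -- Split `4 B x ^ 2 = 4 B (x ^ 2 - 1) + 4 B`; then `r` is `4 / 3` of the total constant `40 / 3
    -- A + 4 B`.
    refine abs_le_barrier (p := 0) (q := 4 * B) (r := 160 / 9 * A + 16 / 3 * B) le_rfl
      (by positivity) (by positivity) (fun x _ => hasDerivAt_steinSolDeriv2 h1 h2 x)
      (fun x hx => ?_) ?_ hx
    · nlinarith [hk x, mul_le_mul_of_nonneg_left (three_quarters_le_barrier hx)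
        (by positivity : 0 ≤ 160 / 9 * A + 16 / 3 * B)]
    · refine tendsto_mul_exp_neg_sq_of_le (C := 20 * A) fun x hx => ?_
      have e1 : |x * steinSolDeriv h x| ≤ x * (17 / 3 * A) := by
        rw [abs_mul, abs_of_nonneg hx]
        exact mul_le_mul_of_nonneg_left (abs_steinSolDeriv_le h1 hA x) hx
      have e2 : |2 * x * h' (x ^ 2)| ≤ 2 * x * A := by
        rw [abs_mul, abs_of_nonneg (by positivity : 0 ≤ 2 * x)]
        exact mul_le_mul_of_nonneg_left (hA _ (sq_nonneg x)) (by positivity)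
      have e3 := abs_steinSol_le hc hL hA0 hx
      have e4 : 8 / 3 * A / (1 + x) ≤ 8 / 3 * A := div_le_self (by positivity) (by linarith)
      have e5 := abs_add_le (x * steinSolDeriv h x) (steinSol h x + 2 * x * h' (x ^ 2))
      have e6 := abs_add_le (steinSol h x) (2 * x * h' (x ^ 2))
      have e7 : A * x ≤ A * (1 + x ^ 2) :=
        mul_le_mul_of_nonneg_left (by nlinarith [sq_nonneg (x - 1)]) hA0
      rw [steinSolDeriv2]
      nlinarith [mul_nonneg hA0 (sq_nonneg x)]
  have h5 : |x * steinSolDeriv2 h h' x| ≤ 4 * B * x ^ 2 + (160 / 9 * A + 16 / 3 * B) := by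
    rw [abs_mul, abs_of_nonneg hx]
    have h4 : x * ((160 / 9 * A + 16 / 3 * B) / (1 + x)) ≤ 160 / 9 * A + 16 / 3 * B := by
      rw [mul_div_assoc', div_le_iff₀ (by positivity)]
      nlinarith
    nlinarith [mul_le_mul_of_nonneg_left hψ2 hx]
  have h6 := abs_add_le (x * steinSolDeriv2 h h' x)
    (2 * steinSolDeriv h x + (2 * h' (x ^ 2) + 4 * x ^ 2 * h'' (x ^ 2)))
  rw [steinSolDeriv3]
  linarith [hk x]

end Bounds

/-! ### Trapezoid rule -/

/-- Error of the trapezoid rule for a function whose third derivative exists and is bounded. -/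
theorem abs_trapezoid_error_le {ψ ψ₁ ψ₂ ψ₃ : ℝ → ℝ} (h1 : ∀ x, HasDerivAt ψ (ψ₁ x) x)
    (h2 : ∀ x, HasDerivAt ψ₁ (ψ₂ x) x) (h3 : ∀ x, HasDerivAt ψ₂ (ψ₃ x) x) {x δ K : ℝ}
    (hδ : 0 ≤ δ) (hK : ∀ t ∈ Icc (x - δ) (x + δ), |ψ₃ t| ≤ K) :
    |ψ (x + δ) - ψ (x - δ) - δ * (ψ₁ (x + δ) + ψ₁ (x - δ))| ≤ 2 * K * δ ^ 3 := by
  have hK0 : 0 ≤ K := (abs_nonneg _).trans (hK x ⟨by linarith, by linarith⟩)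
  have hp : ∀ {φ φ' : ℝ → ℝ}, (∀ y, HasDerivAt φ (φ' y) y) → ∀ t,
      HasDerivAt (fun t => φ (x + t)) (φ' (x + t)) t := fun h t =>
    (h (x + t)).comp_const_add x t
  have hm : ∀ {φ φ' : ℝ → ℝ}, (∀ y, HasDerivAt φ (φ' y) y) → ∀ t,
      HasDerivAt (fun t => φ (x - t)) (-φ' (x - t)) t := fun h t =>
    (h (x - t)).comp_const_sub x t
  -- View the error as a function of the half-width `t`: the `ψ₁` terms cancel in its derivative,
  -- leaving a difference of `ψ₂` that the mean value inequality controls.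
  have hd : ∀ t, HasDerivAt (fun t => ψ (x + t) - ψ (x - t) - t * (ψ₁ (x + t) + ψ₁ (x - t)))
      (-(t * (ψ₂ (x + t) - ψ₂ (x - t)))) t := fun t =>
    (((hp h1 t).fun_sub (hm h1 t)).fun_sub
      ((hasDerivAt_id' t).fun_mul ((hp h2 t).fun_add (hm h2 t)))).congr_deriv (by ring)
  have hb : ∀ t ∈ Icc 0 δ, ‖-(t * (ψ₂ (x + t) - ψ₂ (x - t)))‖ ≤ 2 * K * δ ^ 2 := by
    rintro t ⟨ht0, htδ⟩
    have h4 := (convex_Icc (x - δ) (x + δ)).norm_image_sub_le_of_norm_hasDerivWithin_le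
      (fun z _ => (h3 z).hasDerivWithinAt) (fun z hz => hK z hz)
      (⟨by linarith, by linarith⟩ : x - t ∈ Icc (x - δ) (x + δ))
      (⟨by linarith, by linarith⟩ : x + t ∈ Icc (x - δ) (x + δ))
    rw [show x + t - (x - t) = 2 * t by ring, Real.norm_eq_abs (2 * t),
      abs_of_nonneg (by positivity : 0 ≤ 2 * t)] at h4
    rw [norm_neg, norm_mul, Real.norm_eq_abs t, abs_of_nonneg ht0]
    calc t * ‖ψ₂ (x + t) - ψ₂ (x - t)‖ ≤ t * (K * (2 * t)) := mul_le_mul_of_nonneg_left h4 ht0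
      _ = 2 * K * t ^ 2 := by ring
      _ ≤ 2 * K * δ ^ 2 := by gcongr
  have := (convex_Icc 0 δ).norm_image_sub_le_of_norm_hasDerivWithin_le
    (fun z _ => (hd z).hasDerivWithinAt) hb (⟨le_rfl, hδ⟩ : (0 : ℝ) ∈ Icc 0 δ)
    (⟨hδ, le_rfl⟩ : δ ∈ Icc 0 δ)
  simp only [add_zero, sub_zero, sub_self, zero_mul, Real.norm_eq_abs, abs_of_nonneg hδ] at this
  calc _ ≤ _ := this
    _ = _ := by ring

/-! ### Two treatments: reduction to a sum of signs -/

/-- The centred rank of the first of two treatments, normalised to be a sign. -/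
noncomputable def rankSign (τ : Equiv.Perm (Fin 2)) : ℝ := 2 * centredRank τ 0

theorem rankSign_eq (τ : Equiv.Perm (Fin 2)) : rankSign τ = 1 ∨ rankSign τ = -1 := by
  have h : (τ 0 : ℕ) = 1 ∨ (τ 0 : ℕ) = 0 := by omega
  rcases h with h | h <;> simp only [rankSign, centredRank, h] <;> norm_num

theorem rankSign_swap_mul (τ : Equiv.Perm (Fin 2)) :
    rankSign (Equiv.swap 0 1 * τ) = -rankSign τ := by
  have h : ∀ τ : Equiv.Perm (Fin 2),
      ((Equiv.swap 0 1 * τ : Equiv.Perm (Fin 2)) 0 : ℕ) + (τ 0 : ℕ) = 1 := by decide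
  have := congrArg (Nat.cast (R := ℝ)) (h τ)
  push_cast [-Equiv.Perm.coe_mul] at this
  simp only [rankSign, centredRank]
  push_cast [-Equiv.Perm.coe_mul]
  linarith

theorem centredRank_one (τ : Equiv.Perm (Fin 2)) : centredRank τ 1 = -centredRank τ 0 := by
  have h : ∀ τ : Equiv.Perm (Fin 2), (τ 0 : ℕ) + (τ 1 : ℕ) = 1 := by decide
  have := congrArg (Nat.cast (R := ℝ)) (h τ)
  push_cast at this
  simp only [centredRank]
  push_cast
  linarith

variable {n : ℕ}

/-- The normalised sum of the rank signs. -/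
noncomputable def signSum (σ : Fin n → Equiv.Perm (Fin 2)) : ℝ :=
  1 / √(n : ℝ) * ∑ i, rankSign (σ i)

/-- The two rank sums are opposite, so the statistic is `2 * (12 / (6 n))` times the squared sum of
centred ranks, and each sign is twice a centred rank. -/
theorem statistic_eq_signSum_sq (σ : Fin n → Equiv.Perm (Fin 2)) :
    statistic σ = signSum σ ^ 2 := by
  have h : rankSum σ 1 = -rankSum σ 0 := by
    simp only [rankSum, centredRank_one, Finset.sum_neg_distrib, mul_neg]
  rw [statistic, Fin.sum_univ_two, h, rankSum, signSum]
  simp only [rankSign, ← Finset.mul_sum]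
  push_cast
  have h1 : √(12 : ℝ) ^ 2 = 12 := Real.sq_sqrt (by norm_num)
  have h2 : √((2 : ℝ) * (2 + 1) * n) ^ 2 = 2 * (2 + 1) * n := Real.sq_sqrt (by positivity)
  have h3 : √(n : ℝ) ^ 2 = n := Real.sq_sqrt (by positivity)
  rw [neg_sq]
  simp only [mul_pow, div_pow, h1, h2, h3]
  rcases eq_or_ne (n : ℝ) 0 with hn | hn
  · simp [hn]
  · field_simp
    ring

/-! ### Sign flips and the Stein identity -/

/-- Reverse the ranking of the `i`-th trial. -/
def flipAt (i : Fin n) (σ : Fin n → Equiv.Perm (Fin 2)) : Fin n → Equiv.Perm (Fin 2) :=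
  Function.update σ i (Equiv.swap 0 1 * σ i)

theorem flipAt_involutive (i : Fin n) : Function.Involutive (flipAt i) := fun σ => by
  simp [flipAt, ← mul_assoc]

theorem sum_comp_flipAt (i : Fin n) (g : (Fin n → Equiv.Perm (Fin 2)) → ℝ) :
    ∑ σ, g (flipAt i σ) = ∑ σ, g σ :=
  Equiv.sum_comp (flipAt_involutive i).toPerm g

theorem rankSign_flipAt (i : Fin n) (σ : Fin n → Equiv.Perm (Fin 2)) :
    rankSign (flipAt i σ i) = -rankSign (σ i) := by
  rw [flipAt, Function.update_self, rankSign_swap_mul]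

theorem signSum_flipAt (i : Fin n) (σ : Fin n → Equiv.Perm (Fin 2)) :
    signSum (flipAt i σ) = signSum σ - 2 * (1 / √(n : ℝ)) * rankSign (σ i) := by
  have h : ∑ j, (rankSign (flipAt i σ j) - rankSign (σ j)) = -2 * rankSign (σ i) := by
    rw [Finset.sum_eq_single i]
    · rw [rankSign_flipAt]; ring
    · intro j _ hj
      rw [flipAt, Function.update_of_ne hj, sub_self]
    · simp
  rw [Finset.sum_sub_distrib] at h
  rw [signSum, signSum]
  linear_combination (1 / √(n : ℝ)) * h

theorem sq_le_sq_add_sq {t a b : ℝ} (ha : a ≤ t) (hb : t ≤ b) : t ^ 2 ≤ a ^ 2 + b ^ 2 := by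
  rcases le_total 0 t with h | h <;> nlinarith [sq_nonneg a, sq_nonneg b]

/-- Since the flip negates the `i`-th sign and permutes the rankings, that sign times `ψ (W)` has
the same sum as half the sign times `ψ (W) - ψ (W')`, with `W'` the flipped value. `W` and `W'` are
the ends of an interval of length `2 δ`, so the trapezoid rule applies. Each index costs order `δ ^
4`, and `n δ ^ 4 = 1 / n`. -/
theorem abs_sum_signSum_mul_sub_le_sum {ψ ψ₁ ψ₂ ψ₃ : ℝ → ℝ} (h1 : ∀ x, HasDerivAt ψ (ψ₁ x) x)
    (h2 : ∀ x, HasDerivAt ψ₁ (ψ₂ x) x) (h3 : ∀ x, HasDerivAt ψ₂ (ψ₃ x) x) {a b : ℝ} (hb : 0 ≤ b)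
    (hψ : ∀ x, |ψ₃ x| ≤ a + b * x ^ 2) (hn : 1 ≤ n) :
    |∑ σ : Fin n → Equiv.Perm (Fin 2), (signSum σ * ψ (signSum σ) - ψ₁ (signSum σ))| ≤
      1 / n * ∑ σ : Fin n → Equiv.Perm (Fin 2), (a + 2 * b * signSum σ ^ 2) := by
  have hn0 : (0 : ℝ) < n := by exact_mod_cast hn
  set δ : ℝ := 1 / √(n : ℝ) with hδ
  have hδ0 : 0 < δ := by positivity
  have hδn : δ ^ 2 = 1 / n := by rw [hδ, div_pow, Real.sq_sqrt hn0.le, one_pow]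
  have hpt : ∀ (i : Fin n) (σ : Fin n → Equiv.Perm (Fin 2)),
      |rankSign (σ i) * (ψ (signSum σ) - ψ (signSum (flipAt i σ)))
        - δ * (ψ₁ (signSum σ) + ψ₁ (signSum (flipAt i σ)))|
      ≤ 2 * (a + b * (signSum σ ^ 2 + signSum (flipAt i σ) ^ 2)) * δ ^ 3 := by
    intro i σ
    have hK : ∀ x y t, t ∈ Icc x y → |ψ₃ t| ≤ a + b * (x ^ 2 + y ^ 2) := fun x y t ht =>
      (hψ t).trans (by gcongr; exact sq_le_sq_add_sq ht.1 ht.2)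
    have hf := signSum_flipAt i σ
    rw [← hδ] at hf
    -- The sign decides whether `W` is the right or the left end, hence the midpoint `W - δ` or `W +
    -- δ`.
    rcases rankSign_eq (σ i) with h | h
    · have := abs_trapezoid_error_le h1 h2 h3 (x := signSum σ - δ) hδ0.le (hK _ _)
      rw [show signSum σ - δ + δ = signSum σ by ring,
        show signSum σ - δ - δ = signSum (flipAt i σ) by rw [hf, h]; ring] at this
      rw [h, one_mul, add_comm (signSum σ ^ 2)]
      exact this
    · have := abs_trapezoid_error_le h1 h2 h3 (x := signSum σ + δ) hδ0.le (hK _ _)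
      rw [show signSum σ + δ - δ = signSum σ by ring,
        show signSum σ + δ + δ = signSum (flipAt i σ) by rw [hf, h]; ring] at this
      rw [h, neg_one_mul, neg_sub, add_comm (ψ₁ (signSum σ))]
      exact this
  have hi : ∀ i : Fin n, |∑ σ : Fin n → Equiv.Perm (Fin 2),
      (δ * rankSign (σ i) * ψ (signSum σ) - δ ^ 2 * ψ₁ (signSum σ))| ≤
      δ ^ 4 * ∑ σ : Fin n → Equiv.Perm (Fin 2), (a + 2 * b * signSum σ ^ 2) := by
    intro i
    have e1 : ∑ σ : Fin n → Equiv.Perm (Fin 2),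
        (δ * rankSign (σ i) * ψ (signSum σ) - δ ^ 2 * ψ₁ (signSum σ)) =
        δ / 2 * ∑ σ : Fin n → Equiv.Perm (Fin 2),
          (rankSign (σ i) * (ψ (signSum σ) - ψ (signSum (flipAt i σ)))
            - δ * (ψ₁ (signSum σ) + ψ₁ (signSum (flipAt i σ)))) := by
      have := sum_comp_flipAt i fun σ =>
        δ * rankSign (σ i) * ψ (signSum σ) - δ ^ 2 * ψ₁ (signSum σ)
      have h4 : δ * ∑ σ : Fin n → Equiv.Perm (Fin 2),
          (rankSign (σ i) * (ψ (signSum σ) - ψ (signSum (flipAt i σ)))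
            - δ * (ψ₁ (signSum σ) + ψ₁ (signSum (flipAt i σ)))) =
          ∑ σ : Fin n → Equiv.Perm (Fin 2),
            (δ * rankSign (σ i) * ψ (signSum σ) - δ ^ 2 * ψ₁ (signSum σ)) +
          ∑ σ : Fin n → Equiv.Perm (Fin 2), (δ * rankSign (flipAt i σ i) *
            ψ (signSum (flipAt i σ)) - δ ^ 2 * ψ₁ (signSum (flipAt i σ))) := by
        rw [Finset.mul_sum, ← Finset.sum_add_distrib]
        refine Finset.sum_congr rfl fun σ _ => ?_
        rw [rankSign_flipAt]
        ring
      linarith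
    have e2 : ∑ σ : Fin n → Equiv.Perm (Fin 2), (a + 2 * b * signSum σ ^ 2) =
        ∑ σ : Fin n → Equiv.Perm (Fin 2),
          (a + b * (signSum σ ^ 2 + signSum (flipAt i σ) ^ 2)) := by
      have := sum_comp_flipAt i fun σ => b * signSum σ ^ 2
      simp only [mul_add, Finset.sum_add_distrib, this]
      rw [← Finset.sum_add_distrib (f := fun σ => b * signSum σ ^ 2)]
      congr 1
      exact Finset.sum_congr rfl fun σ _ => by ring
    rw [e1, e2, abs_mul, abs_of_pos (half_pos hδ0)]
    calc _ ≤ δ / 2 * ∑ σ : Fin n → Equiv.Perm (Fin 2),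
            2 * (a + b * (signSum σ ^ 2 + signSum (flipAt i σ) ^ 2)) * δ ^ 3 := by
          gcongr
          exact (Finset.abs_sum_le_sum_abs _ _).trans (Finset.sum_le_sum fun σ _ => hpt i σ)
      _ = _ := by
          rw [Finset.mul_sum, Finset.mul_sum]
          exact Finset.sum_congr rfl fun σ _ => by ring
  have hsum : ∑ σ : Fin n → Equiv.Perm (Fin 2), (signSum σ * ψ (signSum σ) - ψ₁ (signSum σ)) =
      ∑ i : Fin n, ∑ σ : Fin n → Equiv.Perm (Fin 2),
        (δ * rankSign (σ i) * ψ (signSum σ) - δ ^ 2 * ψ₁ (signSum σ)) := by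
    rw [Finset.sum_comm]
    refine Finset.sum_congr rfl fun σ _ => ?_
    rw [Finset.sum_sub_distrib, ← Finset.sum_mul, ← Finset.mul_sum, Finset.sum_const, hδn]
    simp only [signSum, ← hδ, Finset.card_univ, Fintype.card_fin, nsmul_eq_mul]
    field_simp
  rw [hsum]
  calc _ ≤ ∑ i : Fin n, δ ^ 4 *
          ∑ σ : Fin n → Equiv.Perm (Fin 2), (a + 2 * b * signSum σ ^ 2) :=
        (Finset.abs_sum_le_sum_abs _ _).trans (Finset.sum_le_sum fun i _ => hi i)
    _ = _ := by
        rw [Finset.sum_const, Finset.card_univ, Fintype.card_fin, nsmul_eq_mul,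
          show δ ^ 4 = (δ ^ 2) ^ 2 by ring, hδn]
        field_simp

/-- For `ψ (x) = x` the trapezoid rule is exact, so the previous bound with `a = b = 0` already
yields the second moment. -/
theorem sum_signSum_sq (hn : 1 ≤ n) :
    ∑ σ : Fin n → Equiv.Perm (Fin 2), signSum σ ^ 2 =
      Fintype.card (Fin n → Equiv.Perm (Fin 2)) := by
  have := abs_sum_signSum_mul_sub_le_sum (n := n) (ψ := fun x => x) (ψ₁ := fun _ => 1)
    (ψ₂ := fun _ => 0) (ψ₃ := fun _ => 0) (a := 0) (b := 0) hasDerivAt_id'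
    (fun x => hasDerivAt_const x 1) (fun x => hasDerivAt_const x 0) le_rfl (by simp) hn
  simp only [mul_zero, zero_mul, add_zero, Finset.sum_const_zero, abs_nonpos_iff,
    Finset.sum_sub_distrib, sub_eq_zero] at this
  simpa [pow_two] using this

/-- A quantitative Stein identity for normalised sums of independent signs. -/
theorem abs_sum_signSum_mul_sub_le {ψ ψ₁ ψ₂ ψ₃ : ℝ → ℝ} (h1 : ∀ x, HasDerivAt ψ (ψ₁ x) x)
    (h2 : ∀ x, HasDerivAt ψ₁ (ψ₂ x) x) (h3 : ∀ x, HasDerivAt ψ₂ (ψ₃ x) x) {a b : ℝ} (hb : 0 ≤ b)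
    (hψ : ∀ x, |ψ₃ x| ≤ a + b * x ^ 2) (hn : 1 ≤ n) :
    |∑ σ : Fin n → Equiv.Perm (Fin 2), (signSum σ * ψ (signSum σ) - ψ₁ (signSum σ))| ≤
      Fintype.card (Fin n → Equiv.Perm (Fin 2)) * (1 / n * (a + 2 * b)) := by
  refine (abs_sum_signSum_mul_sub_le_sum h1 h2 h3 hb hψ hn).trans (le_of_eq ?_)
  rw [Finset.sum_add_distrib, ← Finset.mul_sum, sum_signSum_sq hn, Finset.sum_const,
    Finset.card_univ, nsmul_eq_mul]
  ring

/-- Mean of `h (F)` over all rankings, compared with the mean of `h (Z ^ 2)`. -/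
theorem abs_mean_statistic_sub_le {h h' h'' : ℝ → ℝ} {A B : ℝ} (hn : 1 ≤ n)
    (h1 : ∀ x, 0 ≤ x → HasDerivWithinAt h (h' x) (Ici 0) x)
    (h2 : ∀ x, 0 ≤ x → HasDerivWithinAt h' (h'' x) (Ici 0) x)
    (hA : ∀ x, 0 ≤ x → |h' x| ≤ A) (hB : ∀ x, 0 ≤ x → |h'' x| ≤ B) :
    |(Fintype.card (Fin n → Equiv.Perm (Fin 2)) : ℝ)⁻¹ *
        ∑ σ : Fin n → Equiv.Perm (Fin 2), h (statistic σ)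
      - ∫ y : ℝ, h (y ^ 2) ∂(gaussianReal 0 1)| ≤ 1 / n * (32 * A + 22 * B) := by
  have hB0 : 0 ≤ B := (abs_nonneg _).trans (hB 0 le_rfl)
  have hc : ContinuousOn h (Ici 0) := fun x hx => (h1 x hx).continuousWithinAt
  have hN : (0 : ℝ) < Fintype.card (Fin n → Equiv.Perm (Fin 2)) := by
    exact_mod_cast Fintype.card_pos
  -- Here `a = 32 A + 6 B` and `b = 8 B`, so `a + 2 b = 32 A + 22 B`.
  have key := abs_sum_signSum_mul_sub_le (n := n) (hasDerivAt_steinSol hc)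
    (hasDerivAt_steinSolDeriv h1) (hasDerivAt_steinSolDeriv2 h1 h2) (by positivity : 0 ≤ 8 * B)
    (abs_steinSolDeriv3_le h1 h2 hA hB) hn
  set N : ℝ := (Fintype.card (Fin n → Equiv.Perm (Fin 2)) : ℝ) with hNdef
  have e : ∑ σ : Fin n → Equiv.Perm (Fin 2),
      (signSum σ * steinSol h (signSum σ) - steinSolDeriv h (signSum σ)) =
      -N * (N⁻¹ * ∑ σ : Fin n → Equiv.Perm (Fin 2), h (statistic σ)
        - ∫ y : ℝ, h (y ^ 2) ∂(gaussianReal 0 1)) := by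
    rw [mul_sub, ← mul_assoc, neg_mul, mul_inv_cancel₀ hN.ne']
    have : ∀ c : ℝ, N * c = ∑ σ : Fin n → Equiv.Perm (Fin 2), c := fun c => by
      rw [Finset.sum_const, Finset.card_univ, nsmul_eq_mul]
    rw [neg_one_mul, neg_mul, sub_neg_eq_add, this, neg_add_eq_sub, ← Finset.sum_sub_distrib]
    refine Finset.sum_congr rfl fun σ _ => ?_
    rw [steinSolDeriv, statistic_eq_signSum_sq]
    ring
  rw [e, abs_mul, abs_neg, abs_of_pos hN] at key
  refine (le_of_mul_le_mul_left key hN).trans (le_of_eq ?_)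
  ring

/-! ### From random rankings to averages over all rankings -/

section Law

variable {Ω : Type*} [MeasurableSpace Ω] {P : Measure Ω} {n r : ℕ}
  {π : Fin n → Ω → Equiv.Perm (Fin r)}

theorem IsUniformRankings.map_eq [IsProbabilityMeasure P] (hπ : IsUniformRankings P π) :
    P.map (fun ω i => π i ω) = uniformOn univ := by
  rw [(iIndepFun_iff_map_fun_eq_pi_map fun i => (hπ.measurable i).aemeasurable).1 hπ.indep]
  simp only [hπ.uniform]
  rw [← uniformOn_pi, pi_univ]

theorem IsUniformRankings.measurable_comp (hπ : IsUniformRankings P π)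
    (g : (Fin n → Equiv.Perm (Fin r)) → ℝ) : Measurable fun ω => g fun i => π i ω := by
  have : Measurable g := measurable_of_finite g
  exact this.comp (measurable_pi_lambda _ hπ.measurable)

theorem IsUniformRankings.integrable_comp [IsProbabilityMeasure P]
    (hπ : IsUniformRankings P π)
    (g : (Fin n → Equiv.Perm (Fin r)) → ℝ) : Integrable (fun ω => g fun i => π i ω) P := by
  obtain ⟨C, hC⟩ := (Set.finite_range fun σ => ‖g σ‖).bddAbove
  exact .of_bound (hπ.measurable_comp g).aestronglyMeasurable C
    (ae_of_all _ fun ω => hC ⟨_, rfl⟩)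

theorem IsUniformRankings.integral_comp [IsProbabilityMeasure P]
    (hπ : IsUniformRankings P π)
    (g : (Fin n → Equiv.Perm (Fin r)) → ℝ) :
    ∫ ω, g (fun i => π i ω) ∂P = (Fintype.card (Fin n → Equiv.Perm (Fin r)) : ℝ)⁻¹ * ∑ σ, g σ := by
  have hg : Measurable g := measurable_of_finite g
  have hm : Measurable fun ω i => π i ω := measurable_pi_lambda _ hπ.measurable
  rw [← integral_map (φ := fun ω i => π i ω) (f := g) hm.aemeasurable hg.aestronglyMeasurable,
    hπ.map_eq, integral_fintype .of_finite, Finset.mul_sum]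
  refine Finset.sum_congr rfl fun σ _ => ?_
  rw [smul_eq_mul, measureReal_def, uniformOn_univ, Measure.count_singleton]
  simp

end Law

/-! ### Chi-square with one degree of freedom as the law of `Z ^ 2` -/

section ChiSquare

theorem chiSquare_one_eq : chiSquare 1 = (gaussianReal 0 1).map fun x => x ^ 2 := by
  have h := (measurePreserving_eval (fun _ : Fin 1 => gaussianReal 0 1) 0).map_eq
  rw [← h, Measure.map_map (by fun_prop) (by fun_prop), chiSquare]
  congr 1
  ext x
  simp

theorem ae_nonneg_chiSquare_one : ∀ᵐ x ∂(chiSquare 1), 0 ≤ x := by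
  rw [chiSquare_one_eq, ae_map_iff (by fun_prop) measurableSet_Ici]
  exact ae_of_all _ fun x => sq_nonneg x

/-- Nothing is known about `h` on the negatives, so it is replaced by the continuous `h (max x 0)`,
equal to it almost everywhere. -/
theorem aestronglyMeasurable_chiSquare_one {h : ℝ → ℝ} (hc : ContinuousOn h (Ici 0)) :
    AEStronglyMeasurable h (chiSquare 1) := by
  have : Continuous fun x => h (max x 0) :=
    hc.comp_continuous (by fun_prop) fun x => le_max_right x 0
  refine this.aestronglyMeasurable.congr ?_
  filter_upwards [ae_nonneg_chiSquare_one] with x hx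
  rw [max_eq_left hx]

theorem integral_chiSquare_one {h : ℝ → ℝ} (hc : ContinuousOn h (Ici 0)) :
    ∫ y, h y ∂(chiSquare 1) = ∫ y : ℝ, h (y ^ 2) ∂(gaussianReal 0 1) := by
  have := aestronglyMeasurable_chiSquare_one hc
  rw [chiSquare_one_eq] at this ⊢
  exact integral_map (by fun_prop) this

theorem integrable_chiSquare_one {h : ℝ → ℝ} {A : ℝ} (hc : ContinuousOn h (Ici 0))
    (hA : ∀ x y, 0 ≤ x → 0 ≤ y → |h x - h y| ≤ A * |x - y|) : Integrable h (chiSquare 1) := by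
  have := aestronglyMeasurable_chiSquare_one hc
  rw [chiSquare_one_eq] at this ⊢
  exact (integrable_map_measure this (by fun_prop)).2 (integrable_comp_sq_gaussianReal hc hA)

end ChiSquare

/-! ### Smoothing Lipschitz functions -/

section Smoothing

/-- The average of `h` over `[x, x + s]`. -/
noncomputable def average (s : ℝ) (h : ℝ → ℝ) (x : ℝ) : ℝ :=
  ((∫ t in (0 : ℝ)..(x + s), h t) - ∫ t in (0 : ℝ)..x, h t) / s

variable {h : ℝ → ℝ} {s L : ℝ}

theorem hasDerivAt_average (hc : Continuous h) (s x : ℝ) :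
    HasDerivAt (average s h) ((h (x + s) - h x) / s) x :=
  (((hc.integral_hasStrictDerivAt 0 (x + s)).hasDerivAt.comp_add_const x s).fun_sub
    (hc.integral_hasStrictDerivAt 0 x).hasDerivAt).div_const s

theorem continuous_average (hc : Continuous h) (s : ℝ) : Continuous (average s h) :=
  continuous_iff_continuousAt.2 fun x => (hasDerivAt_average hc s x).continuousAt

theorem abs_deriv_average_le (hs : 0 < s) (hL : ∀ x y, |h x - h y| ≤ L * |x - y|) (x : ℝ) :
    |(h (x + s) - h x) / s| ≤ L := by
  rw [abs_div, abs_of_pos hs, div_le_iff₀ hs]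
  simpa [abs_of_pos hs] using hL (x + s) x

theorem abs_average_sub_average_le (hc : Continuous h) (hs : 0 < s)
    (hL : ∀ x y, |h x - h y| ≤ L * |x - y|) (x y : ℝ) :
    |average s h x - average s h y| ≤ L * |x - y| :=
  convex_univ.norm_image_sub_le_of_norm_hasDerivWithin_le
    (fun z _ => (hasDerivAt_average hc s z).hasDerivWithinAt)
    (fun z _ => abs_deriv_average_le hs hL z) (mem_univ y) (mem_univ x)

theorem abs_average_sub_le (hc : Continuous h) (hs : 0 < s) (hL0 : 0 ≤ L)
    (hL : ∀ x y, |h x - h y| ≤ L * |x - y|) (x : ℝ) : |average s h x - h x| ≤ L * s := by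
  obtain ⟨z, hz, he⟩ := exists_hasDerivAt_eq_slope (fun x => ∫ t in (0 : ℝ)..x, h t) h
    (by linarith : x < x + s)
    (fun z _ => (hc.integral_hasStrictDerivAt 0 z).hasDerivAt.continuousAt.continuousWithinAt)
    (fun z _ => (hc.integral_hasStrictDerivAt 0 z).hasDerivAt)
  rw [add_sub_cancel_left] at he
  rw [average, ← he]
  refine (hL z x).trans (mul_le_mul_of_nonneg_left ?_ hL0)
  rw [abs_le]
  constructor <;> linarith [hz.1, hz.2]

end Smoothing

/-! ### Rates for smooth and Lipschitz test functions -/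

section Rates

variable {Ω : Type*} [MeasurableSpace Ω] {P : Measure Ω} [IsProbabilityMeasure P] {n : ℕ}
  {π : Fin n → Ω → Equiv.Perm (Fin 2)}

theorem IsUniformRankings.abs_integral_statistic_sub_le (hπ : IsUniformRankings P π) (hn : 1 ≤ n)
    {h h' h'' : ℝ → ℝ} {A B : ℝ} (h1 : ∀ x, 0 ≤ x → HasDerivWithinAt h (h' x) (Ici 0) x)
    (h2 : ∀ x, 0 ≤ x → HasDerivWithinAt h' (h'' x) (Ici 0) x)
    (hA : ∀ x, 0 ≤ x → |h' x| ≤ A) (hB : ∀ x, 0 ≤ x → |h'' x| ≤ B) :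
    |∫ ω, h (statistic fun i => π i ω) ∂P - ∫ y, h y ∂(chiSquare 1)| ≤
      1 / n * (32 * A + 22 * B) := by
  rw [integral_chiSquare_one fun x hx => (h1 x hx).continuousWithinAt,
    hπ.integral_comp fun σ => h (statistic σ)]
  exact abs_mean_statistic_sub_le hn h1 h2 hA hB

theorem abs_integral_sub_integral_le {α : Type*} [MeasurableSpace α] {μ : Measure α}
    [IsProbabilityMeasure μ] {f g : α → ℝ} {C : ℝ} (hf : Integrable f μ) (hg : Integrable g μ)
    (h : ∀ x, |f x - g x| ≤ C) : |∫ x, f x ∂μ - ∫ x, g x ∂μ| ≤ C := by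
  rw [← integral_sub hf hg, ← Real.norm_eq_abs]
  simpa using norm_integral_le_of_norm_le_const (μ := μ) (f := fun x => f x - g x) (ae_of_all _ h)

theorem isProbabilityMeasure_chiSquare_one : IsProbabilityMeasure (chiSquare 1) := by
  rw [chiSquare_one_eq]
  exact Measure.isProbabilityMeasure_map (by fun_prop)

/-- Averaging twice moves `h` by at most `2 s` and gives derivatives bounded by `1` and `2 / s`. The
smooth bound contributes `(32 + 44 / s) / n`, the replacement `2 s` under each law; `s = 1 / √n`
balances the orders. -/
theorem IsUniformRankings.abs_integral_statistic_sub_le_of_lipschitz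
    (hπ : IsUniformRankings P π) (hn : 1 ≤ n) {h : ℝ → ℝ} (hL : ∀ x y, |h x - h y| ≤ 1 * |x - y|)
    (hc : Continuous h) :
    |∫ ω, h (statistic fun i => π i ω) ∂P - ∫ y, h y ∂(chiSquare 1)| ≤
      1 / √(n : ℝ) * (48 + 32 / √(n : ℝ)) := by
  have hn0 : (0 : ℝ) < n := by exact_mod_cast hn
  set s : ℝ := 1 / √(n : ℝ) with hsdef
  have hs : 0 < s := by positivity
  have hsn : 1 / (n : ℝ) = s ^ 2 := by rw [hsdef, div_pow, Real.sq_sqrt hn0.le, one_pow]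
  have hL1 := abs_average_sub_average_le hc hs hL
  have hc1 := continuous_average hc s
  have hL2 := abs_average_sub_average_le hc1 hs hL1
  have hc2 := continuous_average hc1 s
  have hclose : ∀ x, |h x - average s (average s h) x| ≤ 2 * s := fun x => by
    have e1 := abs_average_sub_le hc hs zero_le_one hL x
    have e2 := abs_average_sub_le hc1 hs zero_le_one hL1 x
    rw [abs_le] at e1 e2 ⊢
    constructor <;> linarith [e1.1, e1.2, e2.1, e2.2]
  have hcore := hπ.abs_integral_statistic_sub_le hn
    (fun x _ => (hasDerivAt_average hc1 s x).hasDerivWithinAt)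
    (fun x _ => (((hasDerivAt_average hc s (x + s)).comp_add_const x s).fun_sub
      (hasDerivAt_average hc s x)).div_const s |>.hasDerivWithinAt)
    (fun x _ => abs_deriv_average_le hs hL1 x)
    (B := 2 / s) (fun x _ => by
      rw [abs_div, abs_of_pos hs]
      gcongr
      have e1 := abs_le.1 (abs_deriv_average_le hs hL (x + s))
      have e2 := abs_le.1 (abs_deriv_average_le hs hL x)
      rw [abs_le]
      constructor <;> linarith [e1.1, e1.2, e2.1, e2.2])
  have := isProbabilityMeasure_chiSquare_one
  have hP := abs_integral_sub_integral_le (hπ.integrable_comp fun σ => h (statistic σ))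
    (hπ.integrable_comp fun σ => average s (average s h) (statistic σ)) fun ω => hclose _
  have hχ := abs_integral_sub_integral_le
    (integrable_chiSquare_one hc.continuousOn fun x y _ _ => hL x y)
    (integrable_chiSquare_one hc2.continuousOn fun x y _ _ => hL2 x y) hclose
  have hfin : 1 / (n : ℝ) * (32 * 1 + 22 * (2 / s)) = 32 * s ^ 2 + 44 * s := by
    rw [hsn]; field_simp; ring
  have hgoal : s * (48 + 32 / √(n : ℝ)) = 48 * s + 32 * s ^ 2 := by
    rw [show 32 / √(n : ℝ) = 32 * s by rw [hsdef]; ring]; ring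
  rw [hfin] at hcore
  rw [hgoal]
  rw [abs_le] at hcore hP hχ ⊢
  constructor <;> linarith [hcore.1, hcore.2, hP.1, hP.2, hχ.1, hχ.2]

end Rates

/-! ### Derivatives and norms on the half-line -/

section Smooth

variable {j k : ℕ} {h : ℝ → ℝ}

theorem MemCb.abs_derivPos_le_supNorm (hh : MemCb j k h) {m : ℕ} (hj : j ≤ m) (hk : m ≤ k) {x : ℝ}
    (hx : 0 ≤ x) : |derivPos m h x| ≤ supNorm (derivPos m h) := by
  obtain ⟨C, hC⟩ := hh.bounded m hj hk
  exact le_ciSup (f := fun x : Ici (0 : ℝ) => |derivPos m h x|)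
    ⟨C, by rintro _ ⟨y, rfl⟩; exact hC y y.2⟩ ⟨x, hx⟩

theorem MemCb.hasDerivWithinAt (hh : MemCb j k h) {m : ℕ} (hm : m < k) {x : ℝ} (hx : 0 ≤ x) :
    HasDerivWithinAt (derivPos m h) (derivPos (m + 1) h x) (Ici 0) x := by
  rw [derivPos, derivPos, iteratedDerivWithin_succ]
  exact (hh.differentiable m hm x hx).hasDerivWithinAt

theorem derivPos_zero (h : ℝ → ℝ) : derivPos 0 h = h := iteratedDerivWithin_zero

end Smooth

end Friedman


open Friedman
theorem proposition1p4 {Ω : Type*} [MeasurableSpace Ω] (P : Measure Ω) [IsProbabilityMeasure P]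
    (n : ℕ) (hn : 1 ≤ n) (π : Fin n → Ω → Equiv.Perm (Fin 2))
    (hπ : Friedman.IsUniformRankings P π) (F : Ω → ℝ)
    (hF : ∀ ω, F ω = Friedman.statistic fun i => π i ω) :
    (Measurable F ∧ Integrable (fun x => x) (P.map F) ∧
      Integrable (fun x => x) (Friedman.chiSquare 1) ∧
      Friedman.wassersteinDist (P.map F) (Friedman.chiSquare 1) ≤
        ENNReal.ofReal (1 / √(n : ℝ) * (87 + 48 / √(n : ℝ)))) ∧
    ∀ h : ℝ → ℝ, Friedman.MemCb 1 2 h →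
      Integrable (fun ω => h (F ω)) P ∧ Integrable h (Friedman.chiSquare 1) ∧
      |∫ ω, h (F ω) ∂P - ∫ y, h y ∂(Friedman.chiSquare 1)| ≤
        1 / (n : ℝ) * (69 + 43 / (n : ℝ)) *
          (Friedman.supNorm (Friedman.derivPos 1 h) + Friedman.supNorm (Friedman.derivPos 2 h)) := by
  obtain rfl : F = fun ω => statistic fun i => π i ω := funext hF
  have hn0 : (0 : ℝ) < n := by exact_mod_cast hn
  have hm := hπ.measurable_comp statistic
  refine ⟨⟨hm, ?_, ?_, iSup₂_le fun h hh => ?_⟩, fun h hh => ?_⟩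
  · rw [integrable_map_measure (by fun_prop) hm.aemeasurable]
    exact hπ.integrable_comp statistic
  · exact integrable_chiSquare_one (A := 1) continuousOn_id fun x y _ _ => (one_mul _).ge
  · refine ENNReal.ofReal_le_ofReal ?_
    rw [integral_map hm.aemeasurable hh.continuous.aestronglyMeasurable]
    refine (hπ.abs_integral_statistic_sub_le_of_lipschitz hn
      (fun x y => by simpa using hh.norm_sub_le x y) hh.continuous).trans ?_
    gcongr <;> norm_num
  · have h1 : ∀ x, 0 ≤ x → HasDerivWithinAt h (derivPos 1 h x) (Set.Ici 0) x := fun x hx => by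
      simpa only [derivPos_zero, zero_add] using hh.hasDerivWithinAt two_pos hx
    have hA : ∀ x, 0 ≤ x → |derivPos 1 h x| ≤ supNorm (derivPos 1 h) :=
      fun x hx => hh.abs_derivPos_le_supNorm le_rfl one_le_two hx
    have hB : ∀ x, 0 ≤ x → |derivPos 2 h x| ≤ supNorm (derivPos 2 h) :=
      fun x hx => hh.abs_derivPos_le_supNorm one_le_two le_rfl hx
    refine ⟨hπ.integrable_comp fun σ => h (statistic σ),
      integrable_chiSquare_one (fun x hx => (h1 x hx).continuousWithinAt)
        (abs_sub_le_of_hasDerivWithinAt h1 hA), ?_⟩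
    refine (hπ.abs_integral_statistic_sub_le hn h1
      (fun x hx => hh.hasDerivWithinAt one_lt_two hx) hA hB).trans ?_
    have hA0 := (abs_nonneg _).trans (hA 0 le_rfl)
    have hB0 := (abs_nonneg _).trans (hB 0 le_rfl)
    have h43 : 0 ≤ 43 / (n : ℝ) := by positivity
    rw [mul_assoc]
    gcongr
    nlinarith [mul_nonneg h43 hA0, mul_nonneg h43 hB0]
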